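/- Let $\Pi$ be a finite graph without loops and multiple edges, and let $W$ be the simply-laced Coxeter group generated by $s_i$ ($i\in\Pi$) subject to $s_i^2=e$, $s_is_j=s_js_i$ if $i,j$ are not adjacent in $\Pi$, and $s_is_js_i=s_js_is_j$ if $i,j$ are adjacent in $\Pi$. Let $u,v\in W$. A reduced word for $(u,v)$ is a word $\mathbf i=(i_1,\dots,i_m)$ in the alphabet $\{+1,-1\}\times\Pi$ (with letters written $\pm i$, where $\varepsilon(\pm i)=\pm1$ and $|\pm i|=i$) that is a shuffle of a reduced word for $u$ in the letters of sign $-1$ and a reduced word for $v$ in the letters of sign $+1$; so $m=\ell(u)+\ell(v)$. Given such a word $\mathbf i$, for $l\in[1,m]$ let $l^-$ be the largest $k<l$ in $[1,m]$ with $|i_k|=|i_l|$, and let $l^-=0$ if there is none. Put $B(\mathbf i)=\{l\in[1,m]: l^->0\}$. Let $\Sigma(\mathbf i)$ be the directed graph with vertex set $[1,m]$ in which $k<l$ are joined by an edge if and only if one of the following holds: (i) $k=l^-$ (a horizontal edge); (ii) $k^-<l^-<k$, $|i_k|$ and $|i_l|$ are adjacent in $\Pi$, and $\varepsilon(i_{l^-})=\varepsilon(i_k)$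 (an inclined edge); (iii) $l^-<k^-<k$, $|i_k|$ and $|i_l|$ are adjacent in $\Pi$, and $\varepsilon(i_{k^-})=-\varepsilon(i_k)$ (an inclined edge). A horizontal (resp. inclined) edge $\{k,l\}$ with $k<l$ is directed from $k$ to $l$ if $\varepsilon(i_k)=+1$ (resp. $\varepsilon(i_k)=-1$), and from $l$ to $k$ otherwise. On $\mathbb Z^m$, with standard basis $(e_k)$ and coordinate functions $\xi_k$, let $\Omega=\sum_{(k\to l)\in\Sigma(\mathbf i)}\xi_k\wedge\xi_l$, where $(\xi_k\wedge\xi_l)(x,y)=\xi_k(x)\xi_l(y)-\xi_l(x)\xi_k(y)$, and let $\tau_k(x)=x-\Omega(x,e_k)e_k$. Let $\Gamma_{\mathbf i}\subset GL_m(\mathbb Z)$ be the group generated by the $\tau_k$ with $k\in B(\mathbf i)$, and let $\Gamma_{\mathbf i}(\mathbb F_2)$ be the group of linear transformations of $\mathbb F_2^m$ obtained from $\Gamma_{\mathbf i}$ by reduction modulo $2$. An undirected graph is called $E_6$-compatible if it is connected and contains an induced subgraph with $6$ vertices isomorphic to the Dynkin graph $E_6$. **Corollary.** For every $i\in\Pi$,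 some reduced word for $(u,v)$ has an entry $\pm i$ if and only if every reduced word for $(u,v)$ has an entry $\pm i$. Let $s$ be the number of such $i\in\Pi$. If $\mathbf i$ is a reduced word for $(u,v)$ such that the induced subgraph of (the underlying undirected graph of) $\Sigma(\mathbf i)$ on the vertex set $B(\mathbf i)$ is $E_6$-compatible, then the number of $\Gamma_{\mathbf i}(\mathbb F_2)$-orbits in $\mathbb F_2^m$ is equal to $3\cdot 2^s$. -/

import Mathlib

/-- The Coxeter matrix of the simply-laced Coxeter group attached to a graph without loops and
multiple edges: `m i i = 1`, `m i j = 3` if `i` and `j` are adjacent, and `m i j = 2` otherwise. -/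
def simplyLacedMatrix {I : Type*} [DecidableEq I] (P : SimpleGraph I) [DecidableRel P.Adj] :
    CoxeterMatrix I where
  M := Matrix.of fun i j => if i = j then 1 else if P.Adj i j then 3 else 2
  isSymm := by
    refine Matrix.IsSymm.ext fun i j => ?_
    simp only [Matrix.of_apply, eq_comm (a := j) (b := i), P.adj_comm j i]
  diagonal := fun i => by simp
  off_diagonal := fun i j h => by
    simp only [Matrix.of_apply, if_neg h]
    split_ifs <;> norm_num

/-- The subword of all letters of sign `e`, with the signs forgotten, of a word in the signed
alphabet `{+1, -1} × I`. -/
def signPart {I : Type*} (e : ℤˣ) (w : List (ℤˣ × I)) : List I :=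
  (w.filter fun a => a.1 = e).map Prod.snd

/-- `w` is a reduced word for the pair `(u, v)`: a shuffle of a reduced word for `u`, written in the
letters of sign `-1`, and a reduced word for `v`, written in the letters of sign `+1`. -/
def IsReducedWordFor {I W : Type*} [Group W] {M : CoxeterMatrix I} (cs : CoxeterSystem M W)
    (u v : W) (w : List (ℤˣ × I)) : Prop :=
  (cs.IsReduced (signPart (-1) w) ∧ cs.wordProd (signPart (-1) w) = u) ∧
    (cs.IsReduced (signPart 1 w) ∧ cs.wordProd (signPart 1 w) = v)

section WordGraph

variable {I : Type*} [DecidableEq I]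

/-- The index `l⁻`: the largest position `k < l` with `|i_k| = |i_l|`, and `⊥` if there is none.
Positions are numbered from `0`, and `⊥` is smaller than each of them. -/
def prevIndex (w : List (ℤˣ × I)) (l : Fin w.length) : WithBot (Fin w.length) :=
  (Finset.univ.filter fun k : Fin w.length => k < l ∧ (w.get k).2 = (w.get l).2).max

/-- The set of bounded positions of a word. -/
def boundedIndices (w : List (ℤˣ × I)) : Set (Fin w.length) :=
  {l | prevIndex w l ≠ ⊥}

/-- `{k, l}` is a horizontal edge with left end `k`. -/
def IsHorizontal (w : List (ℤˣ × I)) (k l : Fin w.length) : Prop :=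
  k < l ∧ prevIndex w l = k

/-- `{k, l}` is an inclined edge with left end `k`. -/
def IsInclined (P : SimpleGraph I) (w : List (ℤˣ × I)) (k l : Fin w.length) : Prop :=
  k < l ∧ P.Adj (w.get k).2 (w.get l).2 ∧
    ((prevIndex w k < prevIndex w l ∧ prevIndex w l < k ∧
        ∃ p : Fin w.length, prevIndex w l = p ∧ (w.get p).1 = (w.get k).1) ∨
      (prevIndex w l < prevIndex w k ∧ prevIndex w k < k ∧
        ∃ p : Fin w.length, prevIndex w k = p ∧ (w.get p).1 = -(w.get k).1))

/-- The directed graph of a word. A horizontal edge is directed from its left end to its right end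
if and only if its left end has sign `+1`; an inclined edge is directed from its left end to its
right end if and only if its left end has sign `-1`. -/
def wordDigraph (P : SimpleGraph I) (w : List (ℤˣ × I)) : Digraph (Fin w.length) where
  Adj a b :=
    (IsHorizontal w a b ∧ (w.get a).1 = 1) ∨ (IsHorizontal w b a ∧ (w.get b).1 ≠ 1) ∨
      (IsInclined P w a b ∧ (w.get a).1 = -1) ∨ (IsInclined P w b a ∧ (w.get b).1 ≠ -1)

end WordGraph

section Transvections

variable {V : Type*} [Fintype V]

open Classical in
/-- The skew-symmetric form `Ω`, the sum over all directed edges `k → l` of `ξ_k ∧ ξ_l`, on the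
lattice `ℤ^V`. -/
noncomputable def omegaForm (G : Digraph V) : LinearMap.BilinForm ℤ (V → ℤ) :=
  ∑ k, ∑ l, if G.Adj k l then
    (LinearMap.mul ℤ ℤ).compl₁₂ (LinearMap.proj k) (LinearMap.proj l) -
      (LinearMap.mul ℤ ℤ).compl₁₂ (LinearMap.proj l) (LinearMap.proj k)
  else 0

open Classical in
theorem omegaForm_apply (G : Digraph V) (x y : V → ℤ) :
    omegaForm G x y = ∑ k, ∑ l, if G.Adj k l then x k * y l - x l * y k else 0 := by
  simp only [omegaForm, LinearMap.sum_apply]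
  refine Finset.sum_congr rfl fun k _ => Finset.sum_congr rfl fun l _ => ?_
  split_ifs <;> simp

theorem omegaForm_self (G : Digraph V) (x : V → ℤ) : omegaForm G x x = 0 := by
  classical
  rw [omegaForm_apply]
  refine Finset.sum_eq_zero fun k _ => Finset.sum_eq_zero fun l _ => ?_
  split_ifs
  · ring
  · rfl

variable [DecidableEq V]

/-- The symplectic transvection `τ_k : x ↦ x - Ω(x, e_k) e_k` of `ℤ^V`. -/
noncomputable def symplecticTransvection (G : Digraph V) (k : V) :
    LinearMap.GeneralLinearGroup ℤ (V → ℤ) :=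
  LinearMap.GeneralLinearGroup.ofLinearEquiv
    (LinearEquiv.transvection (f := -(omegaForm G).flip (Pi.single k 1)) (v := Pi.single k 1)
      (by simp [omegaForm_self]))

theorem symplecticTransvection_apply (G : Digraph V) (k : V) (x : V → ℤ) :
    (symplecticTransvection G k).val x
      = x - omegaForm G x (Pi.single k 1) • (Pi.single k 1 : V → ℤ) := by
  change x + (-(omegaForm G).flip (Pi.single k 1)) x • (Pi.single k 1 : V → ℤ) = _
  simp [sub_eq_add_neg]

/-- The group of linear transformations of `ℤ^V` generated by the symplectic transvections `τ_k`
with `k ∈ B`. -/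
def transvectionGroup (G : Digraph V) (B : Set V) :
    Subgroup (LinearMap.GeneralLinearGroup ℤ (V → ℤ)) :=
  Subgroup.closure (symplecticTransvection G '' B)

/-- Reduction modulo `2` of the matrix entries, from `GL(ℤ^V)` to `GL(𝔽₂^V)`. -/
noncomputable def reductionModTwo :
    LinearMap.GeneralLinearGroup ℤ (V → ℤ) →* LinearMap.GeneralLinearGroup (ZMod 2) (V → ZMod 2) :=
  (Matrix.GeneralLinearGroup.toLin.toMonoidHom.comp
    (Matrix.GeneralLinearGroup.map (Int.castRingHom (ZMod 2)))).comp
    Matrix.GeneralLinearGroup.toLin.symm.toMonoidHom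

/-- The group of linear transformations of `𝔽₂^V` obtained from `transvectionGroup G B` by reduction
modulo `2`. -/
noncomputable def transvectionGroupModTwo (G : Digraph V) (B : Set V) :
    Subgroup (LinearMap.GeneralLinearGroup (ZMod 2) (V → ZMod 2)) :=
  (transvectionGroup G B).map reductionModTwo

end Transvections

/-- The Dynkin graph `E₆`: the path `0 - 1 - 2 - 3 - 4` with a further vertex `5` attached to the
middle vertex `2`. -/
def dynkinE6 : SimpleGraph (Fin 6) :=
  SimpleGraph.fromEdgeSet {s(0, 1), s(1, 2), s(2, 3), s(3, 4), s(2, 5)}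

/-- A graph is `E₆`-compatible if it is connected and contains an induced subgraph isomorphic to
the Dynkin graph `E₆`. -/
def IsE6Compatible {V : Type*} (G : SimpleGraph V) : Prop :=
  G.Connected ∧ ∃ S : Set V, Nonempty (G.induce S ≃g dynkinE6)

/-! Modulo 2 each `τ_k` becomes `x ↦ x + Ω(x, e_k) e_k`. Its orbits have evident invariants: the
coset of `x` modulo the span `U` of the bounded `e_k`, the value of the quadratic function `Q` with
polar form `Ω` and `Q(e_k) = 1`, and, for a fixed vector, the vector itself. The core,
`relatesLevelSets_univ`, shows that these are complete: nonfixed vectors of one coset with equal `Q`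
form one orbit. For `E₆` alone this is a finite check on `𝔽₂⁶`; a connected graph is then grown from
its `E₆` one vertex at a time (`RelatesLevelSets.insert`), the `E₆` giving room to choose
intermediate vectors.

Both values of `Q` occur at nonfixed vectors of every coset (`exists_quad_eq`), so the orbits number
`|Fix| + 2·|V/U|`. The functionals `Ω(·, e_k)`, `k` bounded, are triangular with respect to `k ↦
k⁻`, hence independent (`linearIndependent_omegaModTwo`); so both cardinalities are `2^(m-|B|)`. The
unbounded positions are the first occurrences of letters, which gives `m - |B| = s`.

That the support depends only on `(u, v)` is `mem_of_wordProd_eq`. The parity with which a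
reflection occurs in an inversion sequence depends only on the product of the word; hence the
letters of a reduced word lie in the parabolic subgroup of any other word for the same element, and
a simple reflection in a standard parabolic subgroup is one of its generators. -/

/-! ### Inversions and supports of words in a Coxeter group -/

section Support

variable {I W : Type*} [Group W] {M : CoxeterMatrix I} (cs : CoxeterSystem M W)

open Classical in
/-- The involution `(t, ε) ↦ (sᵢ t sᵢ, ε + [t = sᵢ])` of `W × ℤ/2`. -/
noncomputable def reflectionStep (i : I) (p : W × ZMod 2) : W × ZMod 2 :=
  (cs.simple i * p.1 * cs.simple i, p.2 + if p.1 = cs.simple i then 1 else 0)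

-- Each application of a simple reflection tests the current conjugate of `t`; pulled back to `t`,
-- the successive tests read `t = c⁻ᵏ sⱼ` with `c = sᵢsⱼ`.
open Classical in
theorem reflectionStep_comp_iterate (i j : I) (n : ℕ) (t : W) (ε : ZMod 2) :
    (reflectionStep cs i ∘ reflectionStep cs j)^[n] (t, ε) =
      ((cs.simple i * cs.simple j) ^ n * t * ((cs.simple i * cs.simple j) ^ n)⁻¹,
        ε + ∑ k ∈ Finset.range (2 * n),
          if t = ((cs.simple i * cs.simple j) ^ k)⁻¹ * cs.simple j then 1 else 0) := by
  have hconj : ∀ k : ℕ, cs.simple j * (cs.simple i * cs.simple j) ^ k =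
      ((cs.simple i * cs.simple j) ^ k)⁻¹ * cs.simple j := by
    intro k
    induction k with
    | zero => simp
    | succ k ih =>
      rw [pow_succ, ← mul_assoc, ih, ← pow_succ, pow_succ']
      simp [mul_assoc]
  induction n with
  | zero => simp
  | succ n ih =>
    rw [Function.iterate_succ_apply', ih]
    set c := cs.simple i * cs.simple j with hc
    have h1 : c ^ n * t * (c ^ n)⁻¹ = cs.simple j ↔ t = (c ^ (2 * n))⁻¹ * cs.simple j := by
      rw [mul_inv_eq_iff_eq_mul, hconj, ← eq_inv_mul_iff_mul_eq, ← mul_assoc, ← mul_inv_rev,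
        ← pow_add, two_mul]
    have h2 : cs.simple j * (c ^ n * t * (c ^ n)⁻¹) * cs.simple j = cs.simple i ↔
        t = (c ^ (2 * n + 1))⁻¹ * cs.simple j := by
      have : cs.simple j * (c ^ n * t * (c ^ n)⁻¹) * cs.simple j = cs.simple i ↔
          c ^ n * t * (c ^ n)⁻¹ = c⁻¹ * cs.simple j := by
        constructor
        · intro h
          have := congrArg (fun x => cs.simple j * x * cs.simple j) h
          simpa [mul_assoc, hc] using this
        · intro h
          rw [h]
          simp [mul_assoc, hc]
      rw [this, mul_inv_eq_iff_eq_mul, mul_assoc, hconj, ← eq_inv_mul_iff_mul_eq, ← mul_assoc,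
        ← mul_assoc, ← mul_inv_rev, ← mul_inv_rev, ← pow_succ', ← pow_add]
      rw [show n + (n + 1) = 2 * n + 1 by ring]
    simp only [Function.comp_apply, reflectionStep, h1, h2, mul_add, mul_one,
      Finset.sum_range_succ, Prod.mk.injEq]
    refine ⟨?_, by ring⟩
    rw [pow_succ']
    simp [hc, mul_assoc]

theorem isLiftable_reflectionStep :
    M.IsLiftable (G := Function.End (W × ZMod 2)) (reflectionStep cs) := by
  classical
  intro i j
  funext ⟨t, ε⟩
  have hpow : ∀ (f g : Function.End (W × ZMod 2)) (n : ℕ) (p : W × ZMod 2),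
      ((f * g) ^ n) p = (f ∘ g)^[n] p := by
    intro f g n
    induction n with
    | zero => intro p; rfl
    | succ n ih =>
      intro p
      rw [pow_succ, Function.iterate_succ_apply, ← ih]
      rfl
  refine (hpow _ _ _ _).trans ?_
  -- As `c` to the power `M i j` is trivial, the second half of the tests repeats the first, and the
  -- two cancel modulo 2.
  rw [reflectionStep_comp_iterate, two_mul, Finset.sum_range_add]
  simp only [pow_add, cs.simple_mul_simple_pow, one_mul, inv_one, mul_one]
  rw [CharTwo.add_self_eq_zero, add_zero]
  rfl

/-- The action of a Coxeter group on `W × ℤ/2` that counts inversions modulo `2`. -/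
noncomputable def reflectionAction : W →* Function.End (W × ZMod 2) :=
  cs.lift ⟨reflectionStep cs, isLiftable_reflectionStep cs⟩

open Classical in
theorem reflectionAction_wordProd (ω : List I) (t : W) (ε : ZMod 2) :
    reflectionAction cs (cs.wordProd ω) (t, ε) =
      (cs.wordProd ω * t * (cs.wordProd ω)⁻¹, ε + ((cs.rightInvSeq ω).count t : ZMod 2)) := by
  induction ω with
  | nil => simp; rfl
  | cons i ω ih =>
    rw [cs.wordProd_cons, map_mul]
    change reflectionAction cs (cs.simple i) (reflectionAction cs (cs.wordProd ω) (t, ε)) = _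
    rw [ih]
    have hi : reflectionAction cs (cs.simple i) = reflectionStep cs i :=
      cs.lift_apply_simple (isLiftable_reflectionStep cs) i
    rw [hi]
    have : cs.wordProd ω * t * (cs.wordProd ω)⁻¹ = cs.simple i ↔
        (cs.wordProd ω)⁻¹ * cs.simple i * cs.wordProd ω = t := by
      rw [mul_inv_eq_iff_eq_mul, mul_assoc, inv_mul_eq_iff_eq_mul, eq_comm]
    simp only [reflectionStep, CoxeterSystem.rightInvSeq, List.count_cons, this, Prod.mk.injEq,
      beq_iff_eq]
    refine ⟨by simp [mul_assoc], ?_⟩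
    push_cast
    ring

/-- Every inversion of a reduced word occurs in the inversion sequence of every other word with the
same product. -/
theorem mem_rightInvSeq_of_wordProd_eq {ω ω' : List I} (hω : cs.IsReduced ω)
    (h : cs.wordProd ω = cs.wordProd ω') {t : W} (ht : t ∈ cs.rightInvSeq ω) :
    t ∈ cs.rightInvSeq ω' := by
  classical
  have h1 := reflectionAction_wordProd cs ω t 0
  rw [h, reflectionAction_wordProd cs ω' t 0] at h1
  have h2 := congrArg Prod.snd h1
  -- Reducedness makes the count exactly 1, so the count in the other word is odd.
  simp only [zero_add, List.count_eq_one_of_mem hω.nodup_rightInvSeq ht] at h2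
  by_contra hn
  rw [List.count_eq_zero_of_not_mem hn] at h2
  simp at h2

theorem wordProd_mem_closure {J : Set I} {ω : List I} (h : ∀ i ∈ ω, i ∈ J) :
    cs.wordProd ω ∈ Subgroup.closure (cs.simple '' J) := by
  refine Subgroup.list_prod_mem _ fun x hx => ?_
  obtain ⟨i, hi, rfl⟩ := List.mem_map.1 hx
  exact Subgroup.subset_closure ⟨i, h i hi, rfl⟩

theorem mem_closure_of_mem_rightInvSeq {J : Set I} {ω : List I} (h : ∀ i ∈ ω, i ∈ J) {t : W}
    (ht : t ∈ cs.rightInvSeq ω) : t ∈ Subgroup.closure (cs.simple '' J) := by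
  induction ω with
  | nil => simp at ht
  | cons i ω ih =>
    rw [List.forall_mem_cons] at h
    rw [CoxeterSystem.rightInvSeq, List.mem_cons] at ht
    rcases ht with rfl | ht
    · have := wordProd_mem_closure cs h.2
      exact mul_mem (mul_mem (inv_mem this) (Subgroup.subset_closure ⟨i, h.1, rfl⟩)) this
    · exact ih h.2 ht

/-- The first inversion is `π⁻¹ sᵢ π` with `π` the product of the tail; by induction `π ∈ H`, and
conjugating by `π` recovers `sᵢ`. -/
theorem simple_mem_of_rightInvSeq_subset (H : Subgroup W) {ω : List I}
    (h : ∀ t ∈ cs.rightInvSeq ω, t ∈ H) : ∀ i ∈ ω, cs.simple i ∈ H := by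
  induction ω with
  | nil => simp
  | cons i ω ih =>
    rw [CoxeterSystem.rightInvSeq, List.forall_mem_cons] at h
    have hω := ih h.2
    have hp : cs.wordProd ω ∈ H := by
      refine Subgroup.list_prod_mem _ fun x hx => ?_
      obtain ⟨i, hi, rfl⟩ := List.mem_map.1 hx
      exact hω i hi
    rw [List.forall_mem_cons]
    refine ⟨?_, hω⟩
    have := mul_mem (mul_mem hp h.1) (inv_mem hp)
    simpa [mul_assoc] using this

theorem mem_signPart {e : ℤˣ} {w : List (ℤˣ × I)} {i : I} : i ∈ signPart e w ↔ (e, i) ∈ w := by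
  simp [signPart]

theorem signPart_map_append (a b : List I) (e : ℤˣ) :
    signPart e (a.map (Prod.mk (-1)) ++ b.map (Prod.mk 1)) =
      if e = 1 then b else a := by
  have h1 : ∀ (c : ℤˣ) (l : List I), signPart e (l.map (Prod.mk c)) = if c = e then l else [] := by
    intro c l
    split_ifs with h <;> simp [signPart, List.filter_map, Function.comp_def, h]
  have h2 : ∀ l l' : List (ℤˣ × I), signPart e (l ++ l') = signPart e l ++ signPart e l' := by
    intro l l'
    simp [signPart]
  rw [h2, h1, h1]
  rcases Int.units_eq_one_or e with rfl | rfl <;> simp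

end Support

/-! ### Parabolic subgroups in the simply-laced case -/

section SimplyLaced

variable {I : Type*} [DecidableEq I] (P : SimpleGraph I) [DecidableRel P.Adj]

/-- The action of a simple reflection on the weight lattice of a simply-laced Coxeter group, in the
coordinates given by the fundamental weights. -/
def weightReflection (i : I) (x : I → ℤ) : I → ℤ :=
  fun k => if k = i then -x i else if P.Adj i k then x k + x i else x k

theorem isLiftable_weightReflection :
    (simplyLacedMatrix P).IsLiftable (G := Function.End (I → ℤ)) (weightReflection P) := by
  intro i j
  have hM : simplyLacedMatrix P i j = if i = j then 1 else if P.Adj i j then 3 else 2 := rfl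
  rw [hM]
  by_cases hij : i = j
  · subst hij
    rw [if_pos rfl, pow_one]
    funext x k
    change weightReflection P i (weightReflection P i x) k = x k
    by_cases hk : k = i
    · simp [weightReflection, hk]
    · by_cases hik : P.Adj i k <;> simp [weightReflection, hk, hik]
  have hji : ¬ j = i := fun h => hij h.symm
  rw [if_neg hij]
  by_cases hadj : P.Adj i j
  · rw [if_pos hadj]
    have hadj' := hadj.symm
    funext x k
    change weightReflection P i (weightReflection P j (weightReflection P i (weightReflection P j
      (weightReflection P i (weightReflection P j x))))) k = x k
    by_cases hki : k = i
    · subst hki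
      simp [weightReflection, hij, hji, hadj, hadj']
    by_cases hkj : k = j
    · subst hkj
      simp [weightReflection, hij, hji, hadj, hadj']
    by_cases h1 : P.Adj i k <;> by_cases h2 : P.Adj j k <;>
      simp [weightReflection, hij, hji, hki, hkj, hadj, hadj', h1, h2] <;> ring
  · rw [if_neg hadj]
    have hadj' : ¬ P.Adj j i := fun h => hadj h.symm
    funext x k
    change weightReflection P i (weightReflection P j (weightReflection P i (weightReflection P j
      x))) k = x k
    by_cases hki : k = i
    · subst hki
      simp [weightReflection, hij, hadj']
    by_cases hkj : k = j
    · subst hkj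
      simp [weightReflection, hji, hadj]
    by_cases h1 : P.Adj i k <;> by_cases h2 : P.Adj j k <;>
      (simp [weightReflection, hij, hji, hki, hkj, hadj, hadj', h1, h2]; try ring)

variable {P} {W : Type*} [Group W] (cs : CoxeterSystem (simplyLacedMatrix P) W)

/-- A simple reflection lies in a standard parabolic subgroup only if it is one of its generators. -/
theorem mem_of_simple_mem_closure {J : Set I} {i : I}
    (h : cs.simple i ∈ Subgroup.closure (cs.simple '' J)) : i ∈ J := by
  by_contra hi
  let φ : W →* Function.End (I → ℤ) := cs.lift ⟨weightReflection P, isLiftable_weightReflection P⟩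
  have hφ : ∀ j, φ (cs.simple j) = weightReflection P j :=
    cs.lift_apply_simple (isLiftable_weightReflection P)
  -- The `i`-th fundamental weight is fixed by all `sⱼ` with `j ≠ i`, whereas `sᵢ` negates its
  -- `i`-th coordinate.
  have hfix : ∀ g ∈ Subgroup.closure (cs.simple '' J), φ g (Pi.single i 1) = Pi.single i 1 := by
    intro g hg
    induction hg using Subgroup.closure_induction with
    | mem x hx =>
      obtain ⟨j, hj, rfl⟩ := hx
      have hji : j ≠ i := fun e => hi (e ▸ hj)
      rw [hφ]
      funext k
      by_cases hk : k = j
      · subst hk; simp [weightReflection, hji]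
      · simp [weightReflection, hji, hk]
    | one => rw [map_one]; rfl
    | mul x y _ _ hx hy =>
      rw [map_mul]
      exact (congrArg (φ x) hy).trans hx
    | inv x _ hx =>
      have h1 : φ x⁻¹ (φ x (Pi.single i 1)) = Pi.single i 1 := by
        change (φ x⁻¹ * φ x) (Pi.single i 1) = _
        rw [← map_mul, inv_mul_cancel, map_one]
        rfl
      rwa [hx] at h1
  have := congrFun (hfix _ h) i
  rw [hφ] at this
  simp [weightReflection] at this

/-- The support of a reduced word is contained in that of every word with the same product. -/
theorem mem_of_wordProd_eq {ω ω' : List I} (hω : cs.IsReduced ω)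
    (h : cs.wordProd ω = cs.wordProd ω') {i : I} (hi : i ∈ ω) : i ∈ ω' := by
  refine mem_of_simple_mem_closure cs (J := {j | j ∈ ω'}) ?_
  refine simple_mem_of_rightInvSeq_subset cs _ (fun t ht => ?_) i hi
  exact mem_closure_of_mem_rightInvSeq cs (fun _ hj => hj) (mem_rightInvSeq_of_wordProd_eq cs hω h ht)

theorem IsReducedWordFor.mem_of_mem {u v : W} {w w' : List (ℤˣ × I)}
    (hw : IsReducedWordFor cs u v w) (hw' : IsReducedWordFor cs u v w') {e : ℤˣ} {i : I}
    (h : (e, i) ∈ w) : (e, i) ∈ w' := by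
  rw [← mem_signPart] at h ⊢
  rcases Int.units_eq_one_or e with rfl | rfl
  · exact mem_of_wordProd_eq cs hw.2.1 (hw.2.2.trans hw'.2.2.symm) h
  · exact mem_of_wordProd_eq cs hw.1.1 (hw.1.2.trans hw'.1.2.symm) h

/-- Keeps the condition "every reduced word contains the letter" from being vacuous. -/
theorem exists_isReducedWordFor (u v : W) : ∃ w, IsReducedWordFor cs u v w := by
  obtain ⟨a, ha, hau⟩ := cs.exists_isReduced u
  obtain ⟨b, hb, hbv⟩ := cs.exists_isReduced v
  refine ⟨a.map (Prod.mk (-1)) ++ b.map (Prod.mk 1), ?_⟩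
  simp only [IsReducedWordFor, signPart_map_append, if_true]
  simp [ha, hb, hau, hbv]

end SimplyLaced

/-! ### Finite computations in the root lattice `E₆` modulo 2 -/

section E6

/-- The adjacency matrix of the Dynkin graph `E₆` modulo `2`. -/
def gramE6 : Matrix (Fin 6) (Fin 6) (ZMod 2) :=
  !![0, 1, 0, 0, 0, 0; 1, 0, 1, 0, 0, 0; 0, 1, 0, 1, 0, 1; 0, 0, 1, 0, 1, 0; 0, 0, 0, 1, 0, 0;
    0, 0, 1, 0, 0, 0]

/-- The inverse of `gramE6`. -/
def gramInvE6 : Matrix (Fin 6) (Fin 6) (ZMod 2) :=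
  !![0, 1, 0, 0, 0, 1; 1, 0, 0, 0, 0, 0; 0, 0, 0, 0, 0, 1; 0, 0, 0, 0, 1, 0; 0, 0, 0, 1, 0, 1;
    1, 0, 1, 0, 1, 0]

/-- The symplectic form of the root lattice `E₆` modulo `2`. -/
def formE6 (c d : Fin 6 → ZMod 2) : ZMod 2 :=
  c 0 * d 1 + c 1 * d 0 + c 1 * d 2 + c 2 * d 1 + c 2 * d 3 + c 3 * d 2 + c 3 * d 4 + c 4 * d 3 +
    c 2 * d 5 + c 5 * d 2

/-- Half the norm form of the root lattice `E₆` modulo `2`. -/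
def quadE6 (c : Fin 6 → ZMod 2) : ZMod 2 :=
  c 0 + c 1 + c 2 + c 3 + c 4 + c 5 + c 0 * c 1 + c 1 * c 2 + c 2 * c 3 + c 3 * c 4 + c 2 * c 5

/-- The reflection in a simple root of `E₆`, modulo `2`. -/
def reflE6 (i : Fin 6) (c : Fin 6 → ZMod 2) : Fin 6 → ZMod 2 :=
  c + formE6 c (Pi.single i 1) • Pi.single i 1

/-- The distance, in the graph of simple reflections, from a vector of `𝔽₂⁶` to the representative
of its orbit chosen in `repE6`. -/
def depthE6 (c : Fin 6 → ZMod 2) : ℕ :=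
  [0, 2, 2, 1, 2, 4, 1, 0, 4, 2, 0, 1, 3, 3, 2, 1, 6, 4, 2, 3, 4, 8, 3, 4, 5, 3, 1, 2, 4, 4, 3, 2,
    4, 6, 8, 7, 3, 5, 2, 1, 8, 4, 4, 3, 4, 4, 3, 2, 6, 6, 6, 5, 5, 7, 4, 5, 7, 5, 5, 4, 5, 5, 4,
    3].getD ((c 0).val + 2 * (c 1).val + 4 * (c 2).val + 8 * (c 3).val + 16 * (c 4).val +
      32 * (c 5).val) 0

/-- Representatives of the two orbits of nonzero vectors. -/
def repE6 (q : ZMod 2) : Fin 6 → ZMod 2 :=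
  if q = 1 then ![1, 1, 1, 0, 0, 0] else ![0, 1, 0, 1, 0, 0]

theorem forall_fin_six {p : (Fin 6 → ZMod 2) → Prop}
    (h : ∀ c₀ c₁ c₂ c₃ c₄ c₅ : ZMod 2, p ![c₀, c₁, c₂, c₃, c₄, c₅]) (c : Fin 6 → ZMod 2) : p c := by
  have : c = ![c 0, c 1, c 2, c 3, c 4, c 5] := by
    funext i
    fin_cases i <;> rfl
  rw [this]
  exact h _ _ _ _ _ _

/-- `depthE6` serves as a certificate: its strict descent, checked on all nonzero vectors, leads
each of them to the representative with its value of `quadE6`. -/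
theorem exists_depthE6_lt (c : Fin 6 → ZMod 2) (hc : c ≠ 0) :
    c = repE6 (quadE6 c) ∨ ∃ i, depthE6 (reflE6 i c) < depthE6 c := by
  revert hc
  revert c
  refine forall_fin_six ?_
  decide +kernel

theorem reflE6_ne_zero (c : Fin 6 → ZMod 2) (i : Fin 6) (hc : c ≠ 0) : reflE6 i c ≠ 0 := by
  revert hc
  revert i
  revert c
  refine forall_fin_six ?_
  decide +kernel

theorem quadE6_reflE6 (c : Fin 6 → ZMod 2) (i : Fin 6) : quadE6 (reflE6 i c) = quadE6 c := by
  revert i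
  revert c
  refine forall_fin_six ?_
  decide +kernel

/-- The room inside `E₆` used when a vertex is added: form and quadratic value can be prescribed
independently while avoiding `0` and `g`. The coordinates are quantified separately for evaluation
by the kernel. -/
theorem exists_formE6_eq_quadE6_eq (g : Fin 6 → ZMod 2) (hg : g ≠ 0) (b q : ZMod 2) :
    ∃ c₀ c₁ c₂ c₃ c₄ c₅ : ZMod 2, ![c₀, c₁, c₂, c₃, c₄, c₅] ≠ 0 ∧ ![c₀, c₁, c₂, c₃, c₄, c₅] ≠ g ∧
      formE6 ![c₀, c₁, c₂, c₃, c₄, c₅] g = b ∧ quadE6 ![c₀, c₁, c₂, c₃, c₄, c₅] = q := by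
  revert b q hg
  revert g
  refine forall_fin_six ?_
  decide +kernel

theorem exists_ne_zero_quadE6_eq (q : ZMod 2) : ∃ c : Fin 6 → ZMod 2, c ≠ 0 ∧ quadE6 c = q := by
  have : ∀ q, repE6 q ≠ 0 ∧ quadE6 (repE6 q) = q := by decide
  exact ⟨_, this q⟩

theorem gramE6_mul_gramInvE6 : gramE6 * gramInvE6 = 1 := by decide

theorem gramInvE6_mul_gramE6 : gramInvE6 * gramE6 = 1 := by decide

theorem gramE6_eq_one_iff (i j : Fin 6) : gramE6 i j = 1 ↔ dynkinE6.Adj i j := by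
  simp only [dynkinE6, SimpleGraph.fromEdgeSet_adj, Set.mem_insert_iff, Set.mem_singleton_iff,
    Sym2.eq_iff]
  fin_cases i <;> fin_cases j <;> simp [gramE6]

/-- The simple reflections act transitively on the nonzero vectors with a given value of the
quadratic form. -/
theorem rel_of_quadE6_eq {r : (Fin 6 → ZMod 2) → (Fin 6 → ZMod 2) → Prop} (hr : Equivalence r)
    (hstep : ∀ i c, r c (reflE6 i c)) {c d : Fin 6 → ZMod 2} (hc : c ≠ 0) (hd : d ≠ 0)
    (h : quadE6 c = quadE6 d) : r c d := by
  have key : ∀ n, ∀ c : Fin 6 → ZMod 2, c ≠ 0 → depthE6 c = n → r c (repE6 (quadE6 c)) := by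
    intro n
    induction n using Nat.strong_induction_on with
    | _ n ih =>
      intro c hc hn
      rcases exists_depthE6_lt c hc with h | ⟨i, hi⟩
      · rw [← h]
        exact hr.refl c
      · have := ih _ (hn ▸ hi) _ (reflE6_ne_zero c i hc) rfl
        rw [quadE6_reflE6] at this
        exact hr.trans (hstep i c) this
  exact hr.trans (key _ c hc rfl) (hr.symm (h ▸ key _ d hd rfl))

end E6

/-! ### Orbits of transvections over `𝔽₂` for a form containing `E₆` -/

section Orbits

variable {V : Type*} [AddCommGroup V] [Module (ZMod 2) V] {ω : LinearMap.BilinForm (ZMod 2) V}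
  {Q : V → ZMod 2}

theorem add_self_of_module_zmod_two (x : V) : x + x = 0 := by
  have h : (2 : ZMod 2) = 0 := by decide
  rw [← two_smul (ZMod 2) x, h, zero_smul]

theorem map_zero_of_polar (hQ : ∀ x y, Q (x + y) = Q x + Q y + ω x y) : Q 0 = 0 := by
  have := hQ 0 0
  simpa using this

theorem form_comm_of_polar (hQ : ∀ x y, Q (x + y) = Q x + Q y + ω x y) (x y : V) :
    ω x y = ω y x := by
  have h1 := hQ x y
  have h2 := hQ y x
  rw [add_comm y x, h1, add_comm (Q y)] at h2
  exact add_left_cancel h2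

theorem map_smul_of_polar (hQ : ∀ x y, Q (x + y) = Q x + Q y + ω x y) (c : ZMod 2) (x : V) :
    Q (c • x) = c * Q x := by
  have : c = 0 ∨ c = 1 := by revert c; decide
  rcases this with rfl | rfl
  · simp [map_zero_of_polar hQ]
  · simp

section SubE6

variable (hQ : ∀ x y, Q (x + y) = Q x + Q y + ω x y) {a : Fin 6 → V}
  (ha : ∀ i j, ω (a i) (a j) = gramE6 i j) (hQa : ∀ i, Q (a i) = 1)

include ha in
theorem form_linearCombination (c d : Fin 6 → ZMod 2) :
    ω (Fintype.linearCombination (ZMod 2) a c) (Fintype.linearCombination (ZMod 2) a d) =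
      formE6 c d := by
  simp only [Fintype.linearCombination_apply, Fin.sum_univ_six, map_add, map_smul,
    LinearMap.add_apply, LinearMap.smul_apply, smul_eq_mul, ha]
  simp [gramE6, formE6]
  ring

include ha in
theorem form_linearCombination_basis (c : Fin 6 → ZMod 2) (i : Fin 6) :
    ω (Fintype.linearCombination (ZMod 2) a c) (a i) = formE6 c (Pi.single i 1) := by
  rw [← form_linearCombination ha]
  simp

include hQ ha hQa in
theorem quad_linearCombination (c : Fin 6 → ZMod 2) :
    Q (Fintype.linearCombination (ZMod 2) a c) = quadE6 c := by
  simp only [Fintype.linearCombination_apply, Fin.sum_univ_six, map_add, map_smul, hQ,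
    map_smul_of_polar hQ, LinearMap.add_apply, LinearMap.smul_apply, smul_eq_mul, ha, hQa]
  simp [gramE6, quadE6]
  ring

theorem formE6_single (c : Fin 6 → ZMod 2) (i : Fin 6) :
    formE6 c (Pi.single i 1) = (gramE6.mulVec c) i := by
  fin_cases i <;> simp [formE6, gramE6, Matrix.mulVec, dotProduct, Fin.sum_univ_six]

theorem exists_formE6_single_ne_zero {c : Fin 6 → ZMod 2} (hc : c ≠ 0) :
    ∃ i, formE6 c (Pi.single i 1) ≠ 0 := by
  by_contra! h
  apply hc
  have : gramE6.mulVec c = 0 := funext fun i => (formE6_single c i).symm.trans (h i)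
  rw [← Matrix.one_mulVec c, ← gramInvE6_mul_gramE6, ← Matrix.mulVec_mulVec, this,
    Matrix.mulVec_zero]

include ha in
/-- The span of an `E₆`-configuration is an orthogonal direct summand. -/
theorem exists_eq_add_linearCombination (x : V) :
    ∃ f c, x = f + Fintype.linearCombination (ZMod 2) a c ∧ ∀ i, ω f (a i) = 0 := by
  -- Coordinates of the orthogonal projection of `x` to the span, available because the Gram matrix
  -- is invertible modulo 2.
  set c := gramInvE6.mulVec fun i => ω x (a i) with hc
  refine ⟨x - Fintype.linearCombination (ZMod 2) a c, c, by simp, fun i => ?_⟩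
  rw [map_sub, LinearMap.sub_apply, form_linearCombination_basis ha, formE6_single, hc,
    Matrix.mulVec_mulVec, gramE6_mul_gramInvE6, Matrix.one_mulVec, sub_self]

theorem form_linearCombination_of_orthogonal {f : V} (hf : ∀ i, ω f (a i) = 0)
    (c : Fin 6 → ZMod 2) : ω f (Fintype.linearCombination (ZMod 2) a c) = 0 := by
  simp [Fintype.linearCombination_apply, hf]

include hQ ha hQa in
theorem quad_add_linearCombination {f : V} (hf : ∀ i, ω f (a i) = 0) (c : Fin 6 → ZMod 2) :
    Q (f + Fintype.linearCombination (ZMod 2) a c) = Q f + quadE6 c := by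
  rw [hQ, quad_linearCombination hQ ha hQa, form_linearCombination_of_orthogonal hf, add_zero]

include ha in
theorem form_add_linearCombination_basis {f : V} (hf : ∀ i, ω f (a i) = 0) (c : Fin 6 → ZMod 2)
    (i : Fin 6) :
    ω (f + Fintype.linearCombination (ZMod 2) a c) (a i) = formE6 c (Pi.single i 1) := by
  rw [map_add, LinearMap.add_apply, hf, zero_add, form_linearCombination_basis ha]

theorem linearCombination_mem_span (c : Fin 6 → ZMod 2) :
    Fintype.linearCombination (ZMod 2) a c ∈ Submodule.span (ZMod 2) (Set.range a) :=
  (Fintype.range_linearCombination (ZMod 2) a) ▸ LinearMap.mem_range_self _ c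

include hQ ha hQa in
/-- In each coset of the span of an `E₆`-configuration the quadratic function takes both values at
vectors not orthogonal to the configuration. -/
theorem exists_quad_eq (x : V) (q : ZMod 2) :
    ∃ y, y - x ∈ Submodule.span (ZMod 2) (Set.range a) ∧ Q y = q ∧ ∃ i, ω y (a i) ≠ 0 := by
  obtain ⟨f, d, rfl, hf⟩ := exists_eq_add_linearCombination ha x
  obtain ⟨c, hc, hq⟩ := exists_ne_zero_quadE6_eq (q - Q f)
  refine ⟨f + Fintype.linearCombination (ZMod 2) a c, ?_, ?_, ?_⟩
  · rw [add_sub_add_left_eq_sub]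
    exact sub_mem (linearCombination_mem_span c) (linearCombination_mem_span d)
  · rw [quad_add_linearCombination hQ ha hQa hf, hq, add_sub_cancel]
  · obtain ⟨i, hi⟩ := exists_formE6_single_ne_zero hc
    exact ⟨i, by rwa [form_add_linearCombination_basis ha hf]⟩

-- Supplies the intermediate vector of the induction, with `z` the new basis vector. If `z` has a
-- component in the `E₆` span, that component allows the pairing to be chosen; otherwise the pairing
-- is constant on the coset, whence the implication in the conclusion.
include hQ ha hQa in
theorem exists_quad_eq_of_form_eq (x z : V) (q : ZMod 2) :
    ∃ y, y - x ∈ Submodule.span (ZMod 2) (Set.range a) ∧ Q y = q ∧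
      (ω x z = 1 → ω y z = 1) ∧ (∃ i, ω y (a i) ≠ 0) ∧ ∃ i, ω (y + z) (a i) ≠ 0 := by
  obtain ⟨f, d, rfl, hf⟩ := exists_eq_add_linearCombination ha x
  obtain ⟨h, g, rfl, hh⟩ := exists_eq_add_linearCombination ha z
  have hform : ∀ c, ω (f + Fintype.linearCombination (ZMod 2) a c)
      (h + Fintype.linearCombination (ZMod 2) a g) = ω f h + formE6 c g := by
    intro c
    rw [map_add, map_add, LinearMap.add_apply, LinearMap.add_apply,
      form_linearCombination_of_orthogonal hf, form_linearCombination ha,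
      form_comm_of_polar hQ (Fintype.linearCombination (ZMod 2) a c),
      form_linearCombination_of_orthogonal hh, add_zero, zero_add]
  have hfh : ∀ i, ω (f + h) (a i) = 0 := fun i => by
    rw [map_add, LinearMap.add_apply, hf, hh, add_zero]
  obtain ⟨c, hc, hcg, hq, hb⟩ : ∃ c : Fin 6 → ZMod 2, c ≠ 0 ∧ c + g ≠ 0 ∧ quadE6 c = q - Q f ∧
      (ω f h + formE6 d g = 1 → ω f h + formE6 c g = 1) := by
    by_cases hg : g = 0
    · subst hg
      obtain ⟨c, hc, hq⟩ := exists_ne_zero_quadE6_eq (q - Q f)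
      exact ⟨c, hc, by simpa using hc, hq, by simp [formE6]⟩
    · obtain ⟨c₀, c₁, c₂, c₃, c₄, c₅, hc, hcg, hb, hq⟩ :=
        exists_formE6_eq_quadE6_eq g hg (1 - ω f h) (q - Q f)
      refine ⟨_, hc, fun h0 => hcg ?_, hq, fun _ => by rw [hb, add_sub_cancel]⟩
      rw [eq_neg_of_add_eq_zero_left h0]
      funext i
      exact CharTwo.neg_eq _
  refine ⟨f + Fintype.linearCombination (ZMod 2) a c, ?_, ?_, ?_, ?_, ?_⟩
  · rw [add_sub_add_left_eq_sub]
    exact sub_mem (linearCombination_mem_span c) (linearCombination_mem_span d)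
  · rw [quad_add_linearCombination hQ ha hQa hf, hq, add_sub_cancel]
  · rwa [hform, hform]
  · obtain ⟨i, hi⟩ := exists_formE6_single_ne_zero hc
    exact ⟨i, by rwa [form_add_linearCombination_basis ha hf]⟩
  · obtain ⟨i, hi⟩ := exists_formE6_single_ne_zero hcg
    exact ⟨i, by rwa [add_add_add_comm, ← map_add, form_add_linearCombination_basis ha hfh]⟩

end SubE6

/-- Any two vectors that are congruent modulo the span of `e '' S`, have the same value of `Q`, and
are both not orthogonal to `e '' S`, are related by `r`. -/
def RelatesLevelSets {ι : Type*} (ω : LinearMap.BilinForm (ZMod 2) V) (Q : V → ZMod 2)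
    (r : V → V → Prop) (e : ι → V) (S : Set ι) : Prop :=
  ∀ x y, x - y ∈ Submodule.span (ZMod 2) (e '' S) → Q x = Q y → (∃ k ∈ S, ω x (e k) ≠ 0) →
    (∃ k ∈ S, ω y (e k) ≠ 0) → r x y

variable {ι : Type*} {e : ι → V} {r : V → V → Prop}

/-- After splitting off the common component orthogonal to the configuration, the transvections act
on the remaining one as the simple reflections of `E₆`, so `rel_of_quadE6_eq` applies. -/
theorem relatesLevelSets_range (hQ : ∀ x y, Q (x + y) = Q x + Q y + ω x y) (hQe : ∀ k, Q (e k) = 1)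
    (hr : Equivalence r) (hstep : ∀ k x, r x (x + ω x (e k) • e k)) {φ : Fin 6 → ι}
    (hφ : ∀ i j, ω (e (φ i)) (e (φ j)) = gramE6 i j) :
    RelatesLevelSets ω Q r e (Set.range φ) := by
  intro x y hxy hq hx hy
  simp only [Set.exists_range_iff] at hx hy
  have ha : ∀ i j, ω ((e ∘ φ) i) ((e ∘ φ) j) = gramE6 i j := hφ
  have hQa : ∀ i, Q ((e ∘ φ) i) = 1 := fun i => hQe _
  obtain ⟨f, c, rfl, hf⟩ := exists_eq_add_linearCombination ha x
  rw [← Set.range_comp, ← Fintype.range_linearCombination (ZMod 2)] at hxy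
  obtain ⟨u, hu⟩ := hxy
  obtain rfl : y = f + Fintype.linearCombination (ZMod 2) (e ∘ φ) (c - u) := by
    rw [map_sub, hu]
    abel
  have hne : ∀ d : Fin 6 → ZMod 2,
      (∃ i, ω (f + Fintype.linearCombination (ZMod 2) (e ∘ φ) d) (e (φ i)) ≠ 0) → d ≠ 0 := by
    rintro d ⟨i, hi⟩ rfl
    rw [map_zero, add_zero] at hi
    exact hi (hf i)
  rw [quad_add_linearCombination hQ ha hQa hf, quad_add_linearCombination hQ ha hQa hf] at hq
  refine rel_of_quadE6_eq (r := fun c d => r (f + Fintype.linearCombination (ZMod 2) (e ∘ φ) c)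
    (f + Fintype.linearCombination (ZMod 2) (e ∘ φ) d))
    ⟨fun _ => hr.refl _, hr.symm, hr.trans⟩ (fun i d => ?_) (hne _ hx) (hne _ hy)
    (add_left_cancel hq)
  have := hstep (φ i) (f + Fintype.linearCombination (ZMod 2) (e ∘ φ) d)
  have h2 := form_add_linearCombination_basis ha hf d i
  rw [Function.comp_apply] at h2
  rw [h2] at this
  simpa [reflE6, add_assoc] using this

/-- If `x - y` involves `e b`, the path is `x → z → z + e b → y`: the outer steps come from `S`, the
middle one is the transvection at `b`, which requires `ω z (e b) = 1`. -/
theorem RelatesLevelSets.insert (hQ : ∀ x y, Q (x + y) = Q x + Q y + ω x y)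
    (hQe : ∀ k, Q (e k) = 1) (hr : Equivalence r) (hstep : ∀ k x, r x (x + ω x (e k) • e k))
    {φ : Fin 6 → ι} (hφ : ∀ i j, ω (e (φ i)) (e (φ j)) = gramE6 i j) {S : Set ι}
    (hφS : Set.range φ ⊆ S) (hS : RelatesLevelSets ω Q r e S) {b k₀ : ι} (hk₀ : k₀ ∈ S)
    (hb : ω (e b) (e k₀) ≠ 0) : RelatesLevelSets ω Q r e (insert b S) := by
  have hone : ∀ c : ZMod 2, c ≠ 0 → c = 1 := by decide
  have hspan : Submodule.span (ZMod 2) (Set.range (e ∘ φ)) ≤ Submodule.span (ZMod 2) (e '' S) := by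
    apply Submodule.span_mono
    rw [Set.range_comp]
    exact Set.image_mono hφS
  have hspan' : Submodule.span (ZMod 2) (e '' S) ≤ Submodule.span (ZMod 2) (e '' Insert.insert b S) :=
    Submodule.span_mono (Set.image_mono (Set.subset_insert b S))
  have hb' : e b ∈ Submodule.span (ZMod 2) (e '' Insert.insert b S) :=
    Submodule.subset_span ⟨b, Set.mem_insert _ _, rfl⟩
  have hQb : ∀ x, ω x (e b) = 1 → Q (x + e b) = Q x := by
    intro x hx
    rw [hQ, hQe, hx, add_assoc, CharTwo.add_self_eq_zero, add_zero]
  have hstep1 : ∀ x, ω x (e b) = 1 → r x (x + e b) := by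
    intro x hx
    have := hstep b x
    rwa [hx, one_smul] at this
  -- A vector orthogonal to all of `S` but not to `e b` is first moved by the transvection at `b`;
  -- the result pairs nontrivially with the neighbour `k₀`.
  have move : ∀ x, (∃ k ∈ Insert.insert b S, ω x (e k) ≠ 0) → ∃ x', r x x' ∧
      x' - x ∈ Submodule.span (ZMod 2) (e '' Insert.insert b S) ∧ Q x' = Q x ∧
      ∃ k ∈ S, ω x' (e k) ≠ 0 := by
    rintro x ⟨k, hk, hxk⟩
    by_cases h : ∃ k ∈ S, ω x (e k) ≠ 0
    · exact ⟨x, hr.refl x, by simp, rfl, h⟩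
    · push Not at h
      rcases hk with rfl | hk
      · refine ⟨x + e k, hstep1 x (hone _ hxk), by simpa using hb', hQb x (hone _ hxk), k₀, hk₀, ?_⟩
        rwa [map_add, LinearMap.add_apply, h k₀ hk₀, zero_add]
      · exact absurd (h k hk) hxk
  have main : ∀ x y, x - y ∈ Submodule.span (ZMod 2) (e '' Insert.insert b S) → Q x = Q y →
      (∃ k ∈ S, ω x (e k) ≠ 0) → (∃ k ∈ S, ω y (e k) ≠ 0) → r x y := by
    intro x y hxy hq hx hy
    rw [Set.image_insert_eq, Submodule.mem_span_insert] at hxy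
    obtain ⟨c, u, hu, hxy⟩ := hxy
    by_cases hc : c = 0
    · rw [hc, zero_smul, zero_add] at hxy
      exact hS x y (hxy ▸ hu) hq hx hy
    rw [hone c hc, one_smul] at hxy
    -- When `e b` is orthogonal to the `E₆`, its pairing can only be corrected outside the `E₆`, by
    -- adding `e k₀`.
    obtain ⟨x₁, hx₁, hx₁b⟩ : ∃ x₁, x₁ - x ∈ Submodule.span (ZMod 2) (e '' S) ∧ ω x₁ (e b) = 1 := by
      by_cases h : ω x (e b) = 0
      · refine ⟨x + e k₀, ?_, ?_⟩
        · rw [add_sub_cancel_left]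
          exact Submodule.subset_span ⟨k₀, hk₀, rfl⟩
        · rw [map_add, LinearMap.add_apply, h, zero_add, form_comm_of_polar hQ]
          exact hone _ hb
      · exact ⟨x, by simp, hone _ h⟩
    obtain ⟨z, hz, hzq, hzb, ⟨i, hi⟩, ⟨j, hj⟩⟩ :=
      exists_quad_eq_of_form_eq hQ (a := e ∘ φ) hφ (fun i => hQe _) x₁ (e b) (Q x)
    have hzx : z - x ∈ Submodule.span (ZMod 2) (e '' S) := by
      have := add_mem (hspan hz) hx₁
      rwa [sub_add_sub_cancel] at this
    have h1 : r x z := by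
      refine hS x z ?_ hzq.symm hx ⟨φ i, hφS ⟨i, rfl⟩, hi⟩
      rw [← neg_sub]
      exact neg_mem hzx
    have h2 : r (z + e b) y := by
      refine hS _ y ?_ ?_ ⟨φ j, hφS ⟨j, rfl⟩, hj⟩ hy
      · have : z + e b - y = (z - x) + u + (e b + e b) := by
          rw [show z + e b - y = z - x + (x - y) + e b by abel, hxy]
          abel
        rw [this, add_self_of_module_zmod_two, add_zero]
        exact add_mem hzx hu
      · rw [hQb z (hzb hx₁b), hzq, hq]
    exact hr.trans h1 (hr.trans (hstep1 z (hzb hx₁b)) h2)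
  intro x y hxy hq hx hy
  obtain ⟨x', hrx, hx', hqx, hx'S⟩ := move x hx
  obtain ⟨y', hry, hy', hqy, hy'S⟩ := move y hy
  refine hr.trans hrx (hr.trans (main x' y' ?_ ?_ hx'S hy'S) (hr.symm hry))
  · have := sub_mem (add_mem hx' hxy) hy'
    rwa [show x' - x + (x - y) - (y' - y) = x' - y' by abel] at this
  · rw [hqx, hqy, hq]

/-- For a connected graph that contains an induced `E₆`, the nonfixed vectors of each coset with a
given value of `Q` form a single orbit. -/
theorem relatesLevelSets_univ [Finite ι] (hQ : ∀ x y, Q (x + y) = Q x + Q y + ω x y)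
    (hQe : ∀ k, Q (e k) = 1) (hr : Equivalence r) (hstep : ∀ k x, r x (x + ω x (e k) • e k))
    {φ : Fin 6 → ι} (hφ : ∀ i j, ω (e (φ i)) (e (φ j)) = gramE6 i j) {G : SimpleGraph ι}
    (hG : G.Connected) (hGω : ∀ k l, G.Adj k l → ω (e k) (e l) ≠ 0) :
    RelatesLevelSets ω Q r e Set.univ := by
  -- A maximal good set containing the `E₆` has no edge leaving it, so by connectedness it is
  -- everything.
  obtain ⟨S, ⟨hS, hφS⟩, hmax⟩ := Set.Finite.exists_maximal
    (Set.toFinite {S : Set ι | RelatesLevelSets ω Q r e S ∧ Set.range φ ⊆ S})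
    ⟨_, relatesLevelSets_range hQ hQe hr hstep hφ, subset_rfl⟩
  suffices S = Set.univ by rwa [this] at hS
  by_contra hne
  obtain ⟨b, hb⟩ := (Set.ne_univ_iff_exists_notMem S).1 hne
  obtain ⟨p⟩ := hG.preconnected (φ 0) b
  obtain ⟨d, -, hd1, hd2⟩ := p.exists_boundary_dart S (hφS ⟨0, rfl⟩) hb
  refine hd2 (hmax (y := insert d.snd S) ⟨?_, hφS.trans (Set.subset_insert _ _)⟩
    (Set.subset_insert _ _) (Set.mem_insert _ _))
  exact hS.insert hQ hQe hr hstep hφ hφS hd1 (hGω _ _ d.adj.symm)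

/-- The number of orbits: fixed vectors, and two further orbits in each coset. -/
theorem natCard_quotient_eq [Finite V] [Finite ι] (hQ : ∀ x y, Q (x + y) = Q x + Q y + ω x y)
    (hQe : ∀ k, Q (e k) = 1) (s : Setoid V) (hstep : ∀ k x, s x (x + ω x (e k) • e k))
    (hspan : ∀ x y, s x y → x - y ∈ Submodule.span (ZMod 2) (Set.range e))
    (hquad : ∀ x y, s x y → Q x = Q y) (hfix : ∀ x y, s x y → (∀ k, ω x (e k) = 0) → x = y)
    {φ : Fin 6 → ι} (hφ : ∀ i j, ω (e (φ i)) (e (φ j)) = gramE6 i j) {G : SimpleGraph ι}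
    (hG : G.Connected) (hGω : ∀ k l, G.Adj k l → ω (e k) (e l) ≠ 0) :
    Nat.card (Quotient s) = Nat.card {x : V // ∀ k, ω x (e k) = 0} +
      Nat.card (V ⧸ Submodule.span (ZMod 2) (Set.range e)) * 2 := by
  classical
  -- The complete invariant whose values are counted.
  let Φ : V → {x : V // ∀ k, ω x (e k) = 0} ⊕
      ((V ⧸ Submodule.span (ZMod 2) (Set.range e)) × ZMod 2) := fun x =>
    if h : ∀ k, ω x (e k) = 0 then Sum.inl ⟨x, h⟩ else Sum.inr (Submodule.Quotient.mk x, Q x)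
  have hΦ : ∀ x y, Φ x = Φ y ↔ s x y := by
    intro x y
    by_cases hx : ∀ k, ω x (e k) = 0
    · by_cases hy : ∀ k, ω y (e k) = 0
      · simp only [Φ, dif_pos hx, dif_pos hy, Sum.inl.injEq, Subtype.mk.injEq]
        exact ⟨fun h => h ▸ s.refl x, fun h => hfix x y h hx⟩
      · simp only [Φ, dif_pos hx, dif_neg hy, reduceCtorEq, false_iff]
        exact fun h => hy (hfix x y h hx ▸ hx)
    · by_cases hy : ∀ k, ω y (e k) = 0
      · simp only [Φ, dif_neg hx, dif_pos hy, reduceCtorEq, false_iff]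
        exact fun h => hx (hfix y x (s.symm h) hy ▸ hy)
      · simp only [Φ, dif_neg hx, dif_neg hy, Sum.inr.injEq, Prod.mk.injEq]
        refine ⟨fun ⟨h, hq⟩ => ?_, fun h => ⟨(Submodule.Quotient.eq _).2 (hspan x y h), hquad x y h⟩⟩
        push Not at hx hy
        refine relatesLevelSets_univ hQ hQe s.iseqv hstep hφ hG hGω x y ?_ hq ?_ ?_
        · rwa [Set.image_univ, ← Submodule.Quotient.eq]
        · simpa using hx
        · simpa using hy
  have hsurj : Function.Surjective Φ := by
    rintro (⟨x, hx⟩ | ⟨v, q⟩)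
    · exact ⟨x, by simp only [Φ, dif_pos hx]⟩
    · obtain ⟨x, rfl⟩ := Submodule.Quotient.mk_surjective _ v
      obtain ⟨y, hy, hq, i, hi⟩ :=
        exists_quad_eq hQ (a := e ∘ φ) hφ (fun i => hQe _) x q
      refine ⟨y, ?_⟩
      have hn : ¬ ∀ k, ω y (e k) = 0 := fun h => hi (h _)
      simp only [Φ, dif_neg hn, hq, Sum.inr.injEq, Prod.mk.injEq, and_true]
      rw [Submodule.Quotient.eq]
      exact Submodule.span_mono (Set.range_comp_subset_range φ e) hy
  let Ψ : Quotient s → _ := Quotient.lift Φ fun x y h => (hΦ x y).2 h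
  have hΨ : Function.Bijective Ψ := by
    constructor
    · rintro ⟨x⟩ ⟨y⟩ h
      exact Quotient.sound ((hΦ x y).1 h)
    · intro z
      obtain ⟨x, hx⟩ := hsurj z
      exact ⟨Quotient.mk s x, hx⟩
  have : Finite (V ⧸ Submodule.span (ZMod 2) (Set.range e)) :=
    Finite.of_surjective _ (Submodule.Quotient.mk_surjective _)
  rw [Nat.card_eq_of_bijective Ψ hΨ, Nat.card_sum, Nat.card_prod, Nat.card_zmod]

end Orbits

/-! ### Reduction modulo 2 and the invariant quadratic function -/

section ModTwo

variable {V : Type*} [Fintype V]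

open Classical in
/-- The reduction of `omegaForm G` modulo `2`. -/
noncomputable def omegaModTwo (G : Digraph V) : LinearMap.BilinForm (ZMod 2) (V → ZMod 2) :=
  ∑ k, ∑ l, if G.Adj k l then
    (LinearMap.mul (ZMod 2) (ZMod 2)).compl₁₂ (LinearMap.proj k) (LinearMap.proj l) +
      (LinearMap.mul (ZMod 2) (ZMod 2)).compl₁₂ (LinearMap.proj l) (LinearMap.proj k)
  else 0

open Classical in
theorem omegaModTwo_apply (G : Digraph V) (x y : V → ZMod 2) :
    omegaModTwo G x y = ∑ k, ∑ l, if G.Adj k l then x k * y l + x l * y k else 0 := by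
  simp only [omegaModTwo, LinearMap.sum_apply]
  refine Finset.sum_congr rfl fun k _ => Finset.sum_congr rfl fun l _ => ?_
  split_ifs <;> simp

open Classical in
/-- A quadratic function with polar form `omegaModTwo G` and value `1` at the basis vectors. -/
noncomputable def quadModTwo (G : Digraph V) (x : V → ZMod 2) : ZMod 2 :=
  ∑ k, x k + ∑ k, ∑ l, if G.Adj k l then x k * x l else 0

theorem quadModTwo_add (G : Digraph V) (x y : V → ZMod 2) :
    quadModTwo G (x + y) = quadModTwo G x + quadModTwo G y + omegaModTwo G x y := by
  classical
  have h : ∀ a b c a' b' : ZMod 2, a + a' + (b + b' + c) = a + b + (a' + b') + c := by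
    intros; ring
  rw [quadModTwo, quadModTwo, quadModTwo, omegaModTwo_apply]
  iterate 5 rw [← Finset.sum_add_distrib]
  refine Finset.sum_congr rfl fun k _ => ?_
  rw [← h, ← Finset.sum_add_distrib, ← Finset.sum_add_distrib]
  refine congrArg₂ (· + ·) rfl (Finset.sum_congr rfl fun l _ => ?_)
  simp only [Pi.add_apply]
  split_ifs <;> ring

variable [DecidableEq V]

open Classical in
theorem omegaModTwo_single (G : Digraph V) (a b : V) :
    omegaModTwo G (Pi.single a 1) (Pi.single b 1) =
      (if G.Adj a b then 1 else 0) + if G.Adj b a then 1 else 0 := by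
  rw [omegaModTwo_apply]
  have : ∀ k l : V, (if G.Adj k l then
      (Pi.single a (1 : ZMod 2) : V → ZMod 2) k * (Pi.single b (1 : ZMod 2) : V → ZMod 2) l +
        (Pi.single a (1 : ZMod 2) : V → ZMod 2) l * (Pi.single b (1 : ZMod 2) : V → ZMod 2) k
      else 0) = (if k = a then if l = b then if G.Adj a b then 1 else 0 else 0 else 0) +
        if k = b then if l = a then if G.Adj b a then 1 else 0 else 0 else 0 := by
    intro k l
    simp only [Pi.single_apply]
    by_cases h1 : k = a <;> by_cases h2 : l = b <;> by_cases h3 : k = b <;> by_cases h4 : l = a <;>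
      (simp_all; try aesop)
  simp [this, Finset.sum_add_distrib]

theorem quadModTwo_single (G : Digraph V) {a : V} (h : ¬ G.Adj a a) :
    quadModTwo G (Pi.single a 1) = 1 := by
  classical
  rw [quadModTwo, Finset.sum_eq_zero (f := fun k => ∑ l, _), add_zero]
  · simp
  · refine fun k _ => Finset.sum_eq_zero fun l _ => ?_
    split_ifs with hkl
    · by_cases hk : k = a
      · by_cases hl : l = a
        · subst hk hl
          exact absurd hkl h
        · simp [hl]
      · simp [hk]
    · rfl

omit [DecidableEq V] in
theorem intCast_omegaForm (G : Digraph V) (x y : V → ℤ) :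
    ((omegaForm G x y : ℤ) : ZMod 2) = omegaModTwo G (fun k => x k) (fun k => y k) := by
  classical
  rw [omegaForm_apply, omegaModTwo_apply]
  push_cast
  refine Finset.sum_congr rfl fun k _ => Finset.sum_congr rfl fun l _ => ?_
  split_ifs
  · rw [sub_eq_add_neg, CharTwo.neg_eq]
  · rfl

theorem reductionModTwo_apply (g : LinearMap.GeneralLinearGroup ℤ (V → ℤ)) (x : V → ℤ) :
    (reductionModTwo g).val (fun k => (x k : ZMod 2)) = fun k => ((g.val x k : ℤ) : ZMod 2) := by
  obtain ⟨A, rfl⟩ := Matrix.GeneralLinearGroup.toLin.surjective g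
  have h : reductionModTwo (Matrix.GeneralLinearGroup.toLin A) =
      Matrix.GeneralLinearGroup.toLin
        (Matrix.GeneralLinearGroup.map (Int.castRingHom (ZMod 2)) A) := by
    simp [reductionModTwo]
  rw [h]
  funext k
  simp [Matrix.mulVec, dotProduct]

theorem reductionModTwo_symplecticTransvection_apply (G : Digraph V) (k : V) (x : V → ZMod 2) :
    (reductionModTwo (symplecticTransvection G k)).val x =
      x + omegaModTwo G x (Pi.single k 1) • (Pi.single k 1 : V → ZMod 2) := by
  have hx : x = fun l => (((x l).val : ℤ) : ZMod 2) := by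
    funext l
    simp
  have hk : (Pi.single k 1 : V → ZMod 2) = fun l => (((Pi.single k 1 : V → ℤ) l : ℤ) : ZMod 2) := by
    funext l
    by_cases h : l = k
    · subst h; simp
    · simp [h]
  conv_lhs => rw [hx]
  rw [reductionModTwo_apply, symplecticTransvection_apply]
  funext l
  simp only [Pi.sub_apply, Pi.add_apply, Pi.smul_apply, smul_eq_mul]
  push_cast
  rw [intCast_omegaForm, ← hk, ← hx, sub_eq_add_neg, CharTwo.neg_eq, congrFun hk l]
  congr 1
  exact (congrFun hx l).symm

/-- The invariants of the orbits of `transvectionGroupModTwo`. -/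
theorem transvectionGroupModTwo_invariants (G : Digraph V) (hG : ∀ a, ¬ G.Adj a a) (B : Set V)
    {g : LinearMap.GeneralLinearGroup (ZMod 2) (V → ZMod 2)}
    (hg : g ∈ transvectionGroupModTwo G B) (x : V → ZMod 2) :
    g.val x - x ∈ Submodule.span (ZMod 2) (Set.range fun k : B => (Pi.single k.1 1 : V → ZMod 2)) ∧
      quadModTwo G (g.val x) = quadModTwo G x ∧
      ((∀ k : B, omegaModTwo G x (Pi.single k.1 1) = 0) → g.val x = x) := by
  rw [transvectionGroupModTwo, transvectionGroup, MonoidHom.map_closure] at hg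
  induction hg using Subgroup.closure_induction generalizing x with
  | mem g hg =>
    obtain ⟨-, ⟨k, hk, rfl⟩, rfl⟩ := hg
    rw [reductionModTwo_symplecticTransvection_apply]
    refine ⟨?_, ?_, fun h => ?_⟩
    · rw [add_sub_cancel_left]
      exact Submodule.smul_mem _ _ (Submodule.subset_span ⟨⟨k, hk⟩, rfl⟩)
    · have hQ := quadModTwo_add G
      rw [hQ, map_smul_of_polar hQ, quadModTwo_single G (hG k), map_smul, smul_eq_mul]
      -- Here `c = Ω(x, e_k)`: the term `c·Q(e_k)` cancels the polar term `c²`.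
      have : ∀ q c : ZMod 2, q + c * 1 + c * c = q := by decide
      exact this _ _
    · rw [h ⟨k, hk⟩, zero_smul, add_zero]
  | one => simp
  | mul g h _ _ ihg ihh =>
    have e : (g * h).val x = g.val (h.val x) := rfl
    rw [e]
    refine ⟨?_, (ihg _).2.1.trans (ihh x).2.1, fun hx => ?_⟩
    · have := add_mem (ihg (h.val x)).1 (ihh x).1
      rwa [sub_add_sub_cancel] at this
    · rw [(ihh x).2.2 hx, (ihg x).2.2 hx]
  | inv g _ ih =>
    have e : g.val (g⁻¹.val x) = x := by
      change (g * g⁻¹).val x = x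
      rw [mul_inv_cancel]; rfl
    have e' : g⁻¹.val (g.val x) = x := by
      change (g⁻¹ * g).val x = x
      rw [inv_mul_cancel]; rfl
    have := ih (g⁻¹.val x)
    rw [e] at this
    refine ⟨?_, this.2.1.symm, fun hx => ?_⟩
    · rw [← neg_sub]
      exact neg_mem this.1
    · have h2 := (ih x).2.2 hx
      rwa [h2] at e'

/-- Without opposite arrows, which would cancel modulo 2, the Gram matrix of the form is the
adjacency matrix of the underlying graph. -/
theorem natCard_orbits (G : Digraph V) (hG : ∀ a b, G.Adj a b → ¬ G.Adj b a) (B : Set V)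
    (hE : IsE6Compatible (G.toSimpleGraphInclusive.induce B)) :
    Nat.card (MulAction.orbitRel.Quotient (transvectionGroupModTwo G B) (V → ZMod 2)) =
      Nat.card {x : V → ZMod 2 // ∀ k : B, omegaModTwo G x (Pi.single k.1 1) = 0} +
        Nat.card ((V → ZMod 2) ⧸
          Submodule.span (ZMod 2) (Set.range fun k : B => (Pi.single k.1 1 : V → ZMod 2))) * 2 := by
  classical
  have hloop : ∀ a, ¬ G.Adj a a := fun a h => hG a a h h
  obtain ⟨hconn, S, ⟨ψ⟩⟩ := hE
  have hω : ∀ a b, omegaModTwo G (Pi.single a 1) (Pi.single b 1) =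
      if G.toSimpleGraphInclusive.Adj a b then 1 else 0 := by
    intro a b
    rw [omegaModTwo_single]
    simp only [Digraph.toSimpleGraphInclusive, SimpleGraph.fromRel_adj]
    have h1 := hG a b
    have h3 : G.Adj a b → a ≠ b := by rintro h rfl; exact hloop _ h
    have h4 : G.Adj b a → a ≠ b := by rintro h rfl; exact hloop _ h
    by_cases hab : G.Adj a b
    · simp [hab, h1 hab, h3 hab]
    · by_cases hba : G.Adj b a
      · simp [hab, hba, h4 hba]
      · simp [hab, hba]
  have hstep : ∀ (k : B) (x : V → ZMod 2),
      MulAction.orbitRel (transvectionGroupModTwo G B) (V → ZMod 2) x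
        (x + omegaModTwo G x (Pi.single k.1 1) • Pi.single k.1 1) := by
    intro k x
    refine Setoid.symm' _ ?_
    rw [MulAction.orbitRel_apply]
    refine ⟨⟨reductionModTwo (symplecticTransvection G k.1),
      Subgroup.mem_map_of_mem _ (Subgroup.subset_closure ⟨k.1, k.2, rfl⟩)⟩, ?_⟩
    exact reductionModTwo_symplecticTransvection_apply G k.1 x
  have hinv : ∀ x y : V → ZMod 2,
      MulAction.orbitRel (transvectionGroupModTwo G B) (V → ZMod 2) x y →
        ∃ g ∈ transvectionGroupModTwo G B, g.val y = x := by
    rintro x y h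
    rw [MulAction.orbitRel_apply] at h
    obtain ⟨⟨g, hg⟩, rfl⟩ := h
    exact ⟨g, hg, rfl⟩
  refine natCard_quotient_eq (ω := omegaModTwo G) (Q := quadModTwo G)
    (e := fun k : B => (Pi.single k.1 1 : V → ZMod 2)) (quadModTwo_add G)
    (fun k => quadModTwo_single G (hloop k)) _ hstep ?_ ?_ ?_
    (φ := fun i => (ψ.symm i).1) ?_ hconn ?_
  · intro x y h
    obtain ⟨g, hg, rfl⟩ := hinv x y h
    exact (transvectionGroupModTwo_invariants G hloop B hg y).1
  · intro x y h
    obtain ⟨g, hg, rfl⟩ := hinv x y h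
    exact (transvectionGroupModTwo_invariants G hloop B hg y).2.1
  · intro x y h hx
    obtain ⟨g, hg, rfl⟩ := hinv y x (Setoid.symm' _ h)
    exact ((transvectionGroupModTwo_invariants G hloop B hg x).2.2 hx).symm
  · intro i j
    have h := ψ.symm.map_adj_iff (v := i) (w := j)
    rw [← gramE6_eq_one_iff] at h
    simp only [SimpleGraph.comap_adj, Function.Embedding.subtype_apply] at h
    rw [hω]
    simp only [h]
    have : ∀ c : ZMod 2, (if c = 1 then 1 else 0) = c := by decide
    exact this _
  · intro k l h
    have h' : G.toSimpleGraphInclusive.Adj k.1 l.1 := h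
    rw [hω, if_pos h']
    exact one_ne_zero

end ModTwo

/-! ### Cardinalities of quotients and common kernels -/

section Count

variable {K V : Type*} [Field K] [AddCommGroup V] [Module K V] [FiniteDimensional K V]
  {ι : Type*} [Finite ι]

theorem natCard_quotient_span_range {e : ι → V} (he : LinearIndependent K e) :
    Nat.card (V ⧸ Submodule.span K (Set.range e)) =
      Nat.card K ^ (Module.finrank K V - Nat.card ι) := by
  have := Fintype.ofFinite ι
  rw [Module.natCard_eq_pow_finrank (K := K), Submodule.finrank_quotient, finrank_span_eq_card he,
    Nat.card_eq_fintype_card (α := ι)]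

theorem natCard_common_kernel {f : ι → Module.Dual K V} (hf : LinearIndependent K f) :
    Nat.card {x : V // ∀ k, f k x = 0} = Nat.card K ^ (Module.finrank K V - Nat.card ι) := by
  have := Fintype.ofFinite ι
  have h1 := Subspace.finrank_add_finrank_dualCoannihilator_eq (Submodule.span K (Set.range f))
  rw [finrank_span_eq_card hf] at h1
  have h2 : ∀ x : V, x ∈ (Submodule.span K (Set.range f)).dualCoannihilator ↔ ∀ k, f k x = 0 := by
    intro x
    rw [Submodule.mem_dualCoannihilator]
    refine ⟨fun h k => h _ (Submodule.subset_span ⟨k, rfl⟩), fun h φ hφ => ?_⟩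
    induction hφ using Submodule.span_induction with
    | mem φ hφ => obtain ⟨k, rfl⟩ := hφ; exact h k
    | zero => rfl
    | add φ ψ _ _ h1 h2 => simp [h1, h2]
    | smul c φ _ h1 => simp [h1]
  rw [Nat.card_congr (Equiv.subtypeEquivRight fun x => (h2 x).symm),
    Nat.card_eq_fintype_card (α := ι), ← h1, Nat.add_sub_cancel_left]
  exact Module.natCard_eq_pow_finrank (K := K)

end Count

/-! ### The graph of a word and triangularity of its form -/

section Words

variable {I : Type*} [DecidableEq I]

theorem prevIndex_eq_bot_iff {w : List (ℤˣ × I)} {l : Fin w.length} :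
    prevIndex w l = ⊥ ↔ ∀ k < l, (w.get k).2 ≠ (w.get l).2 := by
  rw [prevIndex, Finset.max_eq_bot, Finset.filter_eq_empty_iff]
  simp

theorem lt_of_prevIndex_eq {w : List (ℤˣ × I)} {k l : Fin w.length} (h : prevIndex w l = k) :
    k < l ∧ (w.get k).2 = (w.get l).2 := by
  simpa using Finset.mem_of_max h

theorem le_of_prevIndex_eq {w : List (ℤˣ × I)} {k l j : Fin w.length} (h : prevIndex w l = k)
    (hj : j < l) (hjl : (w.get j).2 = (w.get l).2) : j ≤ k := by
  have : (j : WithBot (Fin w.length)) ≤ prevIndex w l := Finset.le_max (by simpa using ⟨hj, hjl⟩)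
  rw [h] at this
  exact WithBot.coe_le_coe.1 this

theorem eq_of_prevIndex_eq {w : List (ℤˣ × I)} {k l p : Fin w.length} (hk : prevIndex w k = p)
    (hl : prevIndex w l = p) : k = l := by
  have hk' := lt_of_prevIndex_eq hk
  have hl' := lt_of_prevIndex_eq hl
  rcases lt_trichotomy k l with h | h | h
  · exact absurd (le_of_prevIndex_eq hl h (hk'.2.symm.trans hl'.2)) (not_le.2 hk'.1)
  · exact h
  · exact absurd (le_of_prevIndex_eq hk h (hl'.2.symm.trans hk'.2)) (not_le.2 hl'.1)

/-- The source of triangularity: nothing to the left of `l⁻` is joined to `l`. -/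
theorem prevIndex_le_of_edge {P : SimpleGraph I} {w : List (ℤˣ × I)} {k l : Fin w.length}
    (h : IsHorizontal w k l ∨ IsInclined P w k l) : prevIndex w l ≤ k := by
  rcases h with h | ⟨-, -, h | h⟩
  · exact h.2.le
  · exact h.2.1.le
  · exact (h.1.trans h.2.1).le

theorem lt_of_edge {P : SimpleGraph I} {w : List (ℤˣ × I)} {k l : Fin w.length}
    (h : IsHorizontal w k l ∨ IsInclined P w k l) : k < l :=
  h.elim And.left And.left

theorem not_isInclined_of_isHorizontal {P : SimpleGraph I} {w : List (ℤˣ × I)}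
    {k l : Fin w.length} (h : IsHorizontal w k l) : ¬ IsInclined P w k l := fun h' =>
  h'.2.1.ne (lt_of_prevIndex_eq h.2).2

theorem wordDigraph_adj_or {P : SimpleGraph I} {w : List (ℤˣ × I)} {k l : Fin w.length} :
    (wordDigraph P w).Adj k l ∨ (wordDigraph P w).Adj l k ↔
      (IsHorizontal w k l ∨ IsInclined P w k l) ∨ IsHorizontal w l k ∨ IsInclined P w l k := by
  simp only [wordDigraph]
  tauto

theorem wordDigraph_asymm (P : SimpleGraph I) (w : List (ℤˣ × I)) (k l : Fin w.length)
    (h : (wordDigraph P w).Adj k l) : ¬ (wordDigraph P w).Adj l k := by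
  have h1 := @not_isInclined_of_isHorizontal _ _ P w k l
  have h2 := @not_isInclined_of_isHorizontal _ _ P w l k
  have h3 : IsHorizontal w k l ∨ IsInclined P w k l → ¬ (IsHorizontal w l k ∨ IsInclined P w l k) :=
    fun h h' => (lt_of_edge h).not_gt (lt_of_edge h')
  simp only [wordDigraph] at h ⊢
  tauto

theorem omegaModTwo_wordDigraph_eq_zero {P : SimpleGraph I} {w : List (ℤˣ × I)}
    {j k p : Fin w.length} (hk : prevIndex w k = p) (hj : j < p) :
    omegaModTwo (wordDigraph P w) (Pi.single j 1) (Pi.single k 1) = 0 := by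
  classical
  have hjk := hj.trans (lt_of_prevIndex_eq hk).1
  have h : ¬ ((wordDigraph P w).Adj j k ∨ (wordDigraph P w).Adj k j) := by
    rw [wordDigraph_adj_or]
    rintro (h | h)
    · have := prevIndex_le_of_edge h
      rw [hk, WithBot.coe_le_coe] at this
      exact this.not_gt hj
    · exact (lt_of_edge h).not_gt hjk
  rw [not_or] at h
  rw [omegaModTwo_single, if_neg h.1, if_neg h.2, add_zero]

theorem omegaModTwo_wordDigraph_eq_one {P : SimpleGraph I} {w : List (ℤˣ × I)}
    {k p : Fin w.length} (hk : prevIndex w k = p) :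
    omegaModTwo (wordDigraph P w) (Pi.single p 1) (Pi.single k 1) = 1 := by
  classical
  have h : (wordDigraph P w).Adj p k ∨ (wordDigraph P w).Adj k p :=
    wordDigraph_adj_or.2 (Or.inl (Or.inl ⟨(lt_of_prevIndex_eq hk).1, hk⟩))
  rw [omegaModTwo_single]
  rcases h with h | h
  · rw [if_pos h, if_neg (wordDigraph_asymm P w _ _ h), add_zero]
  · rw [if_pos h, if_neg (wordDigraph_asymm P w _ _ h), zero_add]

/-- The functionals `Ω(·, e_k)` with `k` bounded are linearly independent modulo `2`. -/
theorem linearIndependent_omegaModTwo (P : SimpleGraph I) (w : List (ℤˣ × I)) :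
    LinearIndependent (ZMod 2) fun k : boundedIndices w =>
      LinearMap.flip (omegaModTwo (wordDigraph P w)) (Pi.single k.1 1) := by
  classical
  rw [Fintype.linearIndependent_iff]
  intro c hc
  by_contra! hne
  have hp : ∀ k : boundedIndices w, ∃ p : Fin w.length, prevIndex w k = p := fun k => by
    obtain ⟨p, hp⟩ := WithBot.ne_bot_iff_exists.1 k.2
    exact ⟨p, hp.symm⟩
  choose p hp using hp
  -- Take `k` with leftmost `k⁻` in a relation and evaluate at `e_{k⁻}`. As `k ↦ k⁻` is injective,
  -- every other term has `l⁻` further right and vanishes.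
  obtain ⟨k, hk, hmin⟩ := Set.exists_min_image {k | c k ≠ 0} p (Set.toFinite _) hne
  have h := congrArg (fun f => f (Pi.single (p k) 1)) hc
  simp only [LinearMap.sum_apply, LinearMap.smul_apply, LinearMap.flip_apply, smul_eq_mul,
    LinearMap.zero_apply] at h
  rw [Finset.sum_eq_single k, omegaModTwo_wordDigraph_eq_one (hp k), mul_one] at h
  · exact hk h
  · intro l _ hl
    by_cases hcl : c l = 0
    · rw [hcl, zero_mul]
    · rw [omegaModTwo_wordDigraph_eq_zero (hp l), mul_zero]
      refine lt_of_le_of_ne (hmin l hcl) fun h => hl ?_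
      exact Subtype.ext (eq_of_prevIndex_eq (hp l) (h ▸ hp k))
  · simp

/-- The unbounded positions of a word correspond to the letters that occur in it. -/
theorem ncard_support (w : List (ℤˣ × I)) :
    {i : I | ∃ e : ℤˣ, (e, i) ∈ w}.ncard = w.length - Nat.card (boundedIndices w) := by
  have h : {i : I | ∃ e : ℤˣ, (e, i) ∈ w} = (fun k => (w.get k).2) '' (boundedIndices w)ᶜ := by
    ext i
    constructor
    · rintro ⟨e, he⟩
      obtain ⟨k, hk⟩ := List.mem_iff_get.1 he
      -- The first occurrence of a letter is its unique unbounded position.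
      obtain ⟨m, hm, hmin⟩ := Set.exists_min_image {k : Fin w.length | (w.get k).2 = i} id
        (Set.toFinite _) ⟨k, congrArg Prod.snd hk⟩
      refine ⟨m, ?_, hm⟩
      simp only [boundedIndices, Set.mem_compl_iff, Set.mem_ofPred_eq, not_not]
      exact prevIndex_eq_bot_iff.2 fun j hj h => (hmin j (h.trans hm)).not_gt hj
    · rintro ⟨k, -, rfl⟩
      exact ⟨(w.get k).1, List.get_mem w k⟩
  have hinj : Set.InjOn (fun k => (w.get k).2) (boundedIndices w)ᶜ := by
    intro k hk l hl hkl
    simp only [boundedIndices, Set.mem_compl_iff, Set.mem_ofPred_eq, not_not] at hk hl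
    rw [prevIndex_eq_bot_iff] at hk hl
    rcases lt_trichotomy k l with h | h | h
    · exact absurd hkl (hl k h)
    · exact h
    · exact absurd hkl.symm (hk l h)
  rw [h, hinj.ncard_image, Set.ncard_compl, Nat.card_fin, Nat.card_coe_set_eq]

theorem natCard_orbits_wordDigraph (P : SimpleGraph I) (w : List (ℤˣ × I))
    (hE : IsE6Compatible ((wordDigraph P w).toSimpleGraphInclusive.induce (boundedIndices w))) :
    Nat.card (MulAction.orbitRel.Quotient
        (transvectionGroupModTwo (wordDigraph P w) (boundedIndices w)) (Fin w.length → ZMod 2)) =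
      3 * 2 ^ {i : I | ∃ e : ℤˣ, (e, i) ∈ w}.ncard := by
  have h1 := natCard_common_kernel (linearIndependent_omegaModTwo P w)
  have h2 := natCard_quotient_span_range (K := ZMod 2)
    (e := fun k : boundedIndices w => (Pi.single k.1 1 : Fin w.length → ZMod 2)) (by
      have := (Pi.basisFun (ZMod 2) (Fin w.length)).linearIndependent.comp
        (Subtype.val : boundedIndices w → _) Subtype.val_injective
      simpa [Function.comp_def] using this)
  simp only [LinearMap.flip_apply] at h1
  rw [natCard_orbits _ (wordDigraph_asymm P w) _ hE, h1, h2, ncard_support, Nat.card_zmod,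
    Module.finrank_fin_fun]
  ring

end Words

theorem corollary3p9 {I : Type*} [Finite I] [DecidableEq I]
    (P : SimpleGraph I) [DecidableRel P.Adj]
    {W : Type*} [Group W] (cs : CoxeterSystem (simplyLacedMatrix P) W) (u v : W) :
    (∀ i : I,
      (∃ w : List (ℤˣ × I), IsReducedWordFor cs u v w ∧ ∃ e : ℤˣ, (e, i) ∈ w) ↔
        (∀ w : List (ℤˣ × I), IsReducedWordFor cs u v w → ∃ e : ℤˣ, (e, i) ∈ w)) ∧
    ∀ w : List (ℤˣ × I), IsReducedWordFor cs u v w →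
      IsE6Compatible ((wordDigraph P w).toSimpleGraphInclusive.induce (boundedIndices w)) →
      Nat.card (MulAction.orbitRel.Quotient
          (transvectionGroupModTwo (wordDigraph P w) (boundedIndices w))
          (Fin w.length → ZMod 2)) =
        3 * 2 ^ Set.ncard {i : I |
          ∃ w' : List (ℤˣ × I), IsReducedWordFor cs u v w' ∧ ∃ e : ℤˣ, (e, i) ∈ w'} := by
  refine ⟨fun i => ⟨?_, fun h => ?_⟩, fun w hw hE => ?_⟩
  · rintro ⟨w, hw, e, he⟩ w' hw'
    exact ⟨e, hw.mem_of_mem cs hw' he⟩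
  · obtain ⟨w, hw⟩ := exists_isReducedWordFor cs u v
    exact ⟨w, hw, h w hw⟩
  · rw [natCard_orbits_wordDigraph P w hE]
    congr 3
    ext i
    exact ⟨fun h => ⟨w, hw, h⟩, fun ⟨w', hw', e, he⟩ => ⟨e, hw'.mem_of_mem cs hw he⟩⟩
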